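/- Let $q\ge 3$ be a prime power. For integers $d,m\ge 1$ and $1\le r\le\binom{m+d}{d}$, let $e_r(d,m)$ be the maximum, over all $r$-tuples of linearly independent homogeneous polynomials $F_1,\dots,F_r\in\mathbb F_q[X_0,\dots,X_m]$ of degree $d$, of the number of common zeros of $F_1,\dots,F_r$ in $\mathbb P^m(\mathbb F_q)$. Let $p_k=q^k+q^{k-1}+\dots+q+1$ for $k\ge 0$ and $p_k=0$ for $k<0$. For $1\le r\le\binom{m+d}{d}$, let $H_r(d,m)=\sum_{i=1}^m\beta_i q^{m-i}$, where $(\beta_1,\dots,\beta_m)$ is the $r$-th element in descending lexicographic order among all $m$-tuples $(\gamma_1,\dots,\gamma_m)$ of nonnegative integers with $\gamma_1+\dots+\gamma_m\le d$. Then for all integers $m\ge 1$ and $1\le r\le m$, $$e_r(q,m)=q^m+p_{m-r-1}.$$ Moreover, for $1<r\le m$, $$e_r(q,m)>H_r(q-1,m)+p_{m-1}.$$ Consequently, for every $m\ge 2$, it is not true that $e_r(q,m)=H_r(q-1,m)+p_{m-1}$ for all $1\le r\le\binom{m+q-1}{q-1}$; that is, the formula $e_r(d,m)=H_r(d-1,m)+p_{m-1}$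 $(1\le r\le\binom{m+d-1}{d-1})$, conjectured for $1<d<q$, fails to extend to $d=q$. -/

import Mathlib

open MvPolynomial
open scoped LinearAlgebra.Projectivization

noncomputable section

/-- The `m`-dimensional projective space over `K`, as the set of its `K`-rational points:
lines through the origin of `K ^ (m + 1)`, with coordinates indexed by `0, …, m`. -/
abbrev ProjSpace (K : Type*) [Field K] (m : ℕ) : Type _ := ℙ K (Fin (m + 1) → K)

/-- The set of `K`-rational common zeros in projective `m`-space of the polynomials `F i`.
It is used for homogeneous polynomials only, for which vanishing does not depend on the chosen
representative of a point. -/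
def projZeros {K : Type*} [Field K] {m r : ℕ} (F : Fin r → MvPolynomial (Fin (m + 1)) K) :
    Set (ProjSpace K m) :=
  {P | ∀ i, eval P.rep (F i) = 0}

/-- All the numbers of `K`-rational common zeros in projective `m`-space of `r` linearly
independent forms of degree `d` in `m + 1` variables. -/
def zeroCounts (K : Type*) [Field K] (r d m : ℕ) : Set ℕ :=
  {N | ∃ F : Fin r → MvPolynomial (Fin (m + 1)) K,
    (∀ i, (F i).IsHomogeneous d) ∧ LinearIndependent K F ∧ N = (projZeros F).ncard}

/-- `e_r(d, m)`: the maximum number of `K`-rational common zeros in projective `m`-space of `r`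
linearly independent forms of degree `d`. For a finite field `K` it really is a maximum,
see `isGreatest_maxZeros`. -/
def maxZeros (K : Type*) [Field K] (r d m : ℕ) : ℕ := sSup (zeroCounts K r d m)

theorem isGreatest_maxZeros (K : Type*) [Field K] [Finite K] (r d m : ℕ)
    (h : (zeroCounts K r d m).Nonempty) :
    IsGreatest (zeroCounts K r d m) (maxZeros K r d m) := by
  have hb : BddAbove (zeroCounts K r d m) := by
    refine ⟨Nat.card (ProjSpace K m), ?_⟩
    rintro N ⟨F, -, -, rfl⟩
    exact Set.ncard_le_card _
  exact ⟨Nat.sSup_mem h hb, fun _ hN => le_csSup hb hN⟩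

/-- `p_k = q ^ k + ⋯ + q + 1` for `k ≥ 0`, and `p_k = 0` for `k < 0`. -/
def projCount (q : ℕ) (k : ℤ) : ℕ :=
  if 0 ≤ k then ∑ i ∈ Finset.range (k.toNat + 1), q ^ i else 0

/-- The `m`-tuples of nonnegative integers with sum at most `d`; the type `Lex (Fin m → ℕ)`
carries the lexicographic order, in which the first coordinate is the most significant. -/
def boundedTuples (d m : ℕ) : Set (Lex (Fin m → ℕ)) :=
  {γ | ∑ i, ofLex γ i ≤ d}

/-- `β` is the `r`-th element of `boundedTuples d m` in descending lexicographic order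
(counting from `1`): it belongs to that finite set, and exactly `r` of the elements are `≥ β`. -/
def IsRthTuple (r d m : ℕ) (β : Lex (Fin m → ℕ)) : Prop :=
  β ∈ boundedTuples d m ∧ {γ ∈ boundedTuples d m | β ≤ γ}.ncard = r

open Classical in
/-- `H_r(d, m) = β_1 q ^ (m - 1) + ⋯ + β_m q ^ 0`, where `(β_1, …, β_m)` is the `r`-th tuple in
descending lexicographic order among the `m`-tuples of nonnegative integers with sum at most `d`
(and `0` if there is no such tuple, that is, unless `1 ≤ r ≤ (m + d).choose d`). -/
def heijnenPellikaan (q r d m : ℕ) : ℕ :=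
  if h : ∃ β, IsRthTuple r d m β then
    ∑ i : Fin m, ofLex h.choose i * q ^ (m - 1 - (i : ℕ))
  else 0

end

/-!
The upper bound on the number of common zeros is an averaging argument that reduces `r` forms to one.
Let `q = |K|` and `r ≤ m`. A single nonzero form of degree `q` in `m + 1` variables is nonzero at
at least `(q - 1) q ^ (m - 1)` vectors of `K ^ (m + 1)` (`card_eval_ne_zero_of_isHomogeneous_card`).
Given linearly independent forms `F_1, …, F_r`, each of the `q ^ r - 1` nontrivial combinations is
such a form, while a vector at which some `F_i` does not vanish is a nonzero of exactly
`q ^ r - q ^ (r - 1)` combinations. Comparing the two counts, at least `q ^ m - q ^ (m - r)` vectors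
are not common zeros (`pow_le_card_add_pow`). The remaining vectors form a cone, and a cone over `N`
points has `1 + (q - 1) N` elements (`ncard_affine_cone`), so that `N ≤ q ^ m + p_{m - r - 1}`.
The forms `X_i (X_0 ^ (q - 1) - X_i ^ (q - 1))`, `1 ≤ i ≤ r`, attain this bound.

The bound for one form comes from reducing it modulo `X_i ^ q - X_i`. A nonzero polynomial of degree
less than `q` in each variable has at least `∏ (q - α_i)` nonzeros for some exponent `α` in its
support (`exists_mem_support_prod_le_card_eval_ne_zero`), and this product is at least
`(q - 1) q ^ (m - 1)` when all `α_i < q` and `∑ α_i ≤ q` (`pred_mul_pow_le_prod`).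

For the strict inequality, the only tuple with first entry `q - 1` and sum at most `q - 1` is the
lexicographically largest one, so for `r ≥ 2` the first entry of the `r`-th tuple is at most `q - 2`.
This makes `H_r(q - 1, m)` at most `(q - 2) q ^ (m - 1) + q ^ (m - 2)` (`heijnenPellikaan_le`), and
already `H_r(q - 1, m) + p_{m - 1} < q ^ m` as soon as `q ≥ 3`.
-/

/-! ### Nonzeros of a single polynomial -/

theorem card_filter_fin_succ {K : Type*} [Fintype K] {n : ℕ} (p : (Fin (n + 1) → K) → Prop)
    [DecidablePred p] :
    (Finset.univ.filter p).card =
      ∑ s : Fin n → K, (Finset.univ.filter fun y : K => p (Fin.cons y s)).card := by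
  simp only [Finset.card_filter]
  rw [← Equiv.sum_comp (Fin.consEquiv fun _ => K), Fintype.sum_prod_type_right]
  rfl

/-- Some exponent in the support plays the role of a leading exponent: it is built one variable at a
time, as the degree in the first variable followed by the exponent found for the leading
coefficient. No bound on the degrees is needed, because the truncated factor `|K| - α i` is `0`
once `α i ≥ |K|`. -/
theorem exists_mem_support_prod_le_card_eval_ne_zero {K : Type*} [Field K] [Fintype K]
    [DecidableEq K] {n : ℕ} (f : MvPolynomial (Fin n) K) (hf : f ≠ 0) :
    ∃ α ∈ f.support, ∏ i, (Fintype.card K - α i) ≤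
      (Finset.univ.filter fun x : Fin n → K => eval x f ≠ 0).card := by
  induction n with
  | zero =>
    obtain ⟨α, hα⟩ := support_nonempty.2 hf
    refine ⟨α, hα, ?_⟩
    have h0 : eval (0 : Fin 0 → K) f ≠ 0 := by
      rw [eq_C_of_isEmpty f] at hf ⊢
      simpa using hf
    have h1 : 0 < (Finset.univ.filter fun x : Fin 0 → K => eval x f ≠ 0).card :=
      Finset.card_pos.2 ⟨0, Finset.mem_filter.2 ⟨Finset.mem_univ _, h0⟩⟩
    rw [Fin.prod_univ_zero]
    exact h1
  | succ n ih =>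
    set p := finSuccEquiv K n f with hp
    have hp0 : p ≠ 0 := by simpa [hp] using hf
    obtain ⟨α, hα, hle⟩ := ih p.leadingCoeff (Polynomial.leadingCoeff_ne_zero.2 hp0)
    refine ⟨α.cons p.natDegree, (mem_support_coeff_finSuccEquiv).1 hα, ?_⟩
    rw [Fin.prod_univ_succ, card_filter_fin_succ]
    simp only [Finsupp.cons_zero, Finsupp.cons_succ]
    have hs : ∀ s : Fin n → K, eval s p.leadingCoeff ≠ 0 →
        Fintype.card K - p.natDegree ≤
          (Finset.univ.filter fun y : K => eval (Fin.cons y s : Fin (n + 1) → K) f ≠ 0).card := by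
      intro s hs
      set g := p.map (eval s) with hg
      have hg0 : g ≠ 0 := fun h => hs <| by
        have := congrArg (fun r => Polynomial.coeff r p.natDegree) h
        simpa [hg] using this
      have hc : (Finset.univ.filter fun y : K => eval (Fin.cons y s : Fin (n + 1) → K) f = 0).card
          ≤ p.natDegree := by
        refine le_trans (Finset.card_le_card (t := g.roots.toFinset) ?_)
          ((Multiset.toFinset_card_le _).trans
            ((Polynomial.card_roots' g).trans Polynomial.natDegree_map_le))
        intro y hy
        simp only [Finset.mem_filter, Finset.mem_univ, true_and, eval_eq_eval_mv_eval'] at hy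
        simpa [hg0] using hy
      have := Finset.card_filter_add_card_filter_not (s := (Finset.univ : Finset K))
        (fun y : K => eval (Fin.cons y s : Fin (n + 1) → K) f = 0)
      rw [Finset.card_univ] at this
      simp only [ne_eq]
      omega
    calc _ ≤ (Fintype.card K - p.natDegree) *
          (Finset.univ.filter fun s : Fin n → K => eval s p.leadingCoeff ≠ 0).card :=
          Nat.mul_le_mul_left _ hle
      _ = ∑ s ∈ Finset.univ.filter fun s : Fin n → K => eval s p.leadingCoeff ≠ 0,
          (Fintype.card K - p.natDegree) := by rw [Finset.sum_const, smul_eq_mul, mul_comm]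
      _ ≤ _ := (Finset.sum_le_sum fun s h => hs s (Finset.mem_filter.1 h).2).trans
          (Finset.sum_le_sum_of_subset (Finset.filter_subset _ _))

/-- A Weierstrass-type product inequality, `∏ (1 - a i / q) ≥ 1 - ∑ a i / q`, with denominators
cleared; the extra factor `q` on the right avoids the exponent `s.card - 1`. -/
theorem sub_sum_mul_pow_le_prod {ι : Type*} (s : Finset ι) (a : ι → ℕ) (q : ℕ) :
    (q - ∑ i ∈ s, a i) * q ^ s.card ≤ q * ∏ i ∈ s, (q - a i) := by
  classical
  induction s using Finset.induction_on with
  | empty => simp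
  | insert i s hi ih =>
    rw [Finset.sum_insert hi, Finset.card_insert_of_notMem hi, Finset.prod_insert hi]
    set S := ∑ i ∈ s, a i
    have h : (q - (a i + S)) * q ≤ (q - a i) * (q - S) := by
      rcases le_or_gt q (a i + S) with h | h
      · simp [Nat.sub_eq_zero_of_le h]
      · obtain ⟨c, rfl⟩ := Nat.exists_eq_add_of_lt h
        have h1 : a i + S + c + 1 - (a i + S) = c + 1 := by omega
        have h2 : a i + S + c + 1 - a i = S + (c + 1) := by omega
        have h3 : a i + S + c + 1 - S = a i + (c + 1) := by omega
        rw [h1, h2, h3]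
        nlinarith [Nat.zero_le (a i * S)]
    calc _ = ((q - (a i + S)) * q) * q ^ s.card := by ring
      _ ≤ ((q - a i) * (q - S)) * q ^ s.card := Nat.mul_le_mul_right _ h
      _ = (q - a i) * ((q - S) * q ^ s.card) := by ring
      _ ≤ (q - a i) * (q * ∏ i ∈ s, (q - a i)) := Nat.mul_le_mul_left _ ih
      _ = _ := by ring

/-- The minimum is attained at exponents with two nonzero entries `q - 1` and `1`: splitting off one
nonzero entry `t`, the others have sum at most `q - t`, and `(q - t) t ≥ q - 1`. -/
theorem pred_mul_pow_le_prod {n q : ℕ} (hq : 2 ≤ q) (a : Fin (n + 2) → ℕ)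
    (ha : ∀ i, a i < q) (hs : ∑ i, a i ≤ q) :
    (q - 1) * q ^ n ≤ ∏ i, (q - a i) := by
  classical
  rcases eq_or_ne a 0 with rfl | h0
  · have : (q - 1) * q ^ n ≤ q ^ 2 * q ^ n :=
      Nat.mul_le_mul_right _ (by nlinarith [Nat.sub_le q 1])
    simpa [pow_add, mul_comm] using this
  obtain ⟨i, hi⟩ := Function.ne_iff.1 h0
  have hi : a i ≠ 0 := hi
  have hai := ha i
  rw [← Finset.mul_prod_erase _ _ (Finset.mem_univ i)]
  rw [← Finset.add_sum_erase _ _ (Finset.mem_univ i)] at hs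
  have key := sub_sum_mul_pow_le_prod (Finset.univ.erase i) a q
  set S := ∑ j ∈ Finset.univ.erase i, a j
  have hc : (Finset.univ.erase i).card = n + 1 := by simp
  rw [hc] at key
  have key2 : (q - S) * q ^ n ≤ ∏ j ∈ Finset.univ.erase i, (q - a j) := by
    refine Nat.le_of_mul_le_mul_left ?_ (show 0 < q by omega)
    calc _ = (q - S) * q ^ (n + 1) := by ring
      _ ≤ _ := key
  have h : q - 1 ≤ (q - a i) * a i := by
    obtain ⟨c, hc⟩ := Nat.exists_eq_add_of_lt hai
    obtain ⟨b, hb⟩ := Nat.exists_eq_succ_of_ne_zero hi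
    have : q - a i = c + 1 := by omega
    rw [this, hb]
    have : q - 1 = b + c + 1 := by omega
    rw [this]
    simp only [Nat.succ_eq_add_one]
    nlinarith [Nat.zero_le (b * c)]
  calc (q - 1) * q ^ n ≤ ((q - a i) * a i) * q ^ n := Nat.mul_le_mul_right _ h
    _ ≤ ((q - a i) * (q - S)) * q ^ n :=
      Nat.mul_le_mul_right _ (Nat.mul_le_mul_left _ (by omega))
    _ = (q - a i) * ((q - S) * q ^ n) := by ring
    _ ≤ _ := Nat.mul_le_mul_left _ key2

/-- The case of degree `|K|` of Serre's bound for hypersurfaces, in terms of vectors rather than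
projective points. -/
theorem card_eval_ne_zero_of_isHomogeneous_card {K : Type*} [Field K] [Fintype K] [DecidableEq K]
    {n : ℕ} {F : MvPolynomial (Fin (n + 2)) K} (hF : F.IsHomogeneous (Fintype.card K))
    (hF0 : F ≠ 0) :
    (Fintype.card K - 1) * Fintype.card K ^ n ≤
      (Finset.univ.filter fun x : Fin (n + 2) → K => eval x F ≠ 0).card := by
  set q := Fintype.card K with hqdef
  have hq : 2 ≤ q := Fintype.one_lt_card
  set c : Fin (n + 2) → K := fun i => coeff (Finsupp.single i q) F with hc
  -- Replacing each pure power `X i ^ q` by `X i` keeps the values. As `q ≠ 1`, the new linear terms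
  -- cannot cancel against `F`.
  set G : MvPolynomial (Fin (n + 2)) K :=
    F - ∑ i, C (c i) * (X i ^ q - X i) with hG
  have heval : ∀ x, eval x G = eval x F := by
    intro x
    simp [hG, hqdef, FiniteField.pow_card]
  have hcoeff : ∀ β, coeff β G = coeff β F - ∑ i, c i *
      ((if Finsupp.single i q = β then 1 else 0) - (if Finsupp.single i 1 = β then 1 else 0)) := by
    intro β
    simp [hG, coeff_sum, coeff_C_mul, coeff_X_pow, coeff_X]
  have hsingle : ∀ i j : Fin (n + 2), ∀ a b : ℕ, a ≠ 0 →
      (Finsupp.single i a = Finsupp.single j b ↔ i = j ∧ a = b) := by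
    intro i j a b ha
    rw [Finsupp.single_eq_single_iff]
    tauto
  have hq1 : q ≠ 1 := by omega
  have hq0 : q ≠ 0 := by omega
  have hpure : ∀ i, coeff (Finsupp.single i q) G = 0 := by
    intro i
    rw [hcoeff]
    simp [hsingle, hq0, hq1.symm, hc]
  have hdeg : ∀ β ∈ G.support, (∀ i, β i < q) ∧ ∑ i, β i ≤ q := by
    intro β hβ
    rw [mem_support_iff] at hβ
    by_cases h1 : ∃ i, Finsupp.single i 1 = β
    · obtain ⟨i, rfl⟩ := h1
      refine ⟨fun j => ?_, ?_⟩
      · rw [Finsupp.single_apply]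
        split_ifs <;> omega
      · simp [Finsupp.single_apply]
        omega
    by_cases h2 : ∃ i, Finsupp.single i q = β
    · obtain ⟨i, rfl⟩ := h2
      exact absurd (hpure i) hβ
    push Not at h1 h2
    have hβF : coeff β F ≠ 0 := by
      rw [hcoeff] at hβ
      simpa [h1, h2] using hβ
    have hsum : ∑ i, β i = q := by
      have := hF hβF
      simpa [Finsupp.weight_apply, Finsupp.sum_fintype] using this
    refine ⟨fun i => ?_, hsum.le⟩
    by_contra hi
    have hle := Finset.add_sum_erase Finset.univ β (Finset.mem_univ i)
    rw [hsum] at hle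
    have hz : ∑ j ∈ Finset.univ.erase i, β j = 0 := by omega
    apply h2 i
    ext j
    rcases eq_or_ne i j with rfl | hij
    · rw [Finsupp.single_eq_same]
      omega
    · rw [Finsupp.single_apply, if_neg hij]
      exact (Finset.sum_eq_zero_iff.1 hz j (by simp [hij.symm])).symm
  have hG0 : G ≠ 0 := by
    intro h
    have hci : ∀ i, c i = 0 := by
      intro i
      have h1 : coeff (Finsupp.single i 1) F = 0 := by
        refine hF.coeff_eq_zero ?_
        rw [Finsupp.degree_single]
        exact hq1.symm
      have h2 := hcoeff (Finsupp.single i 1)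
      simpa [h, h1, hsingle, hq0, hq1, eq_comm] using h2
    apply hF0
    simpa [hG, hci] using h
  obtain ⟨α, hα, hle⟩ := exists_mem_support_prod_le_card_eval_ne_zero G hG0
  simp only [heval] at hle
  obtain ⟨h1, h2⟩ := hdeg α hα
  exact (pred_mul_pow_le_prod hq _ h1 h2).trans hle

/-! ### From vectors to projective points -/

theorem eval_smul_of_isHomogeneous {σ K : Type*} [Fintype σ] [CommRing K] {d : ℕ}
    {F : MvPolynomial σ K} (hF : F.IsHomogeneous d) (a : K) (v : σ → K) :
    eval (a • v) F = a ^ d * eval v F := by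
  rw [eval_eq', eval_eq', Finset.mul_sum]
  refine Finset.sum_congr rfl fun β hβ => ?_
  have hsum : ∑ i, β i = d := by
    have := hF (mem_support_iff.1 hβ)
    simpa [Finsupp.weight_apply, Finsupp.sum_fintype] using this
  simp only [Pi.smul_apply, smul_eq_mul, mul_pow, Finset.prod_mul_distrib, Finset.prod_pow_eq_pow_sum,
    hsum]
  ring

/-- A cone without its apex consists of the `|K| - 1` nonzero multiples of one representative of each
of its points. -/
theorem ncard_affine_cone {K V : Type*} [Field K] [Finite K] [AddCommGroup V] [Module K V]
    (S : Set (ℙ K V)) (T : Set V) (h : ∀ v (hv : v ≠ 0), Projectivization.mk K v hv ∈ S ↔ v ∈ T) :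
    (T \ {0}).ncard = S.ncard * (Nat.card K - 1) := by
  have hb : Function.Bijective (fun x : S × Kˣ =>
      (⟨x.2 • x.1.1.rep, (h _ (by simp [smul_ne_zero_iff_ne, Projectivization.rep_nonzero])).1
        (by
          convert x.1.2
          conv_rhs => rw [← Projectivization.mk_rep x.1.1]
          exact (Projectivization.mk_eq_mk_iff K _ _ _ _).2 ⟨x.2, rfl⟩),
        by simp [smul_ne_zero_iff_ne, Projectivization.rep_nonzero]⟩ : (T \ {0} : Set V))) := by
    constructor
    · rintro ⟨⟨P, hP⟩, a⟩ ⟨⟨Q, hQ⟩, b⟩ hab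
      have hab : a • P.rep = b • Q.rep := congrArg Subtype.val hab
      have hPQ : P = Q := by
        rw [← P.mk_rep, ← Q.mk_rep]
        refine (Projectivization.mk_eq_mk_iff K _ _ _ _).2 ⟨a⁻¹ * b, ?_⟩
        rw [mul_smul, ← hab, inv_smul_smul]
      subst hPQ
      have : a = b := by
        ext
        exact smul_left_injective K P.rep_nonzero hab
      simp [this]
    · rintro ⟨v, hvT, hv0⟩
      have hv0 : v ≠ 0 := hv0
      obtain ⟨a, ha⟩ := Projectivization.exists_smul_eq_mk_rep K v hv0
      refine ⟨⟨⟨Projectivization.mk K v hv0, (h v hv0).2 hvT⟩, a⁻¹⟩, ?_⟩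
      ext
      simp [← ha]
  rw [← Nat.card_coe_set_eq, ← Nat.card_eq_of_bijective _ hb, Nat.card_prod, Nat.card_units,
    Nat.card_coe_set_eq]

theorem ncard_projZeros {K : Type*} [Field K] [Fintype K] [DecidableEq K] {m r d : ℕ}
    (F : Fin r → MvPolynomial (Fin (m + 1)) K) (hF : ∀ i, (F i).IsHomogeneous d) (hd : d ≠ 0) :
    (projZeros F).ncard * (Fintype.card K - 1) + 1 +
      (Finset.univ.filter fun v : Fin (m + 1) → K => ¬ ∀ i, eval v (F i) = 0).card =
        Fintype.card K ^ (m + 1) := by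
  have hcone := ncard_affine_cone (projZeros F) {v | ∀ i, eval v (F i) = 0} (by
    intro v hv
    obtain ⟨a, ha⟩ := Projectivization.exists_smul_eq_mk_rep K v hv
    simp only [projZeros, Set.mem_ofPred_eq, ← ha, Units.smul_def]
    refine forall_congr' fun i => ?_
    rw [eval_smul_of_isHomogeneous (hF i)]
    simp)
  have h0 : (0 : Fin (m + 1) → K) ∈ {v : Fin (m + 1) → K | ∀ i, eval v (F i) = 0} := by
    intro i
    have := eval_smul_of_isHomogeneous (hF i) 0 0
    simpa [hd] using this
  rw [Nat.card_eq_fintype_card] at hcone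
  rw [← hcone, Set.ncard_sdiff_singleton_add_one h0, Set.ncard_eq_toFinset_card']
  have := Finset.card_filter_add_card_filter_not (s := (Finset.univ : Finset (Fin (m + 1) → K)))
    (fun v => ∀ i, eval v (F i) = 0)
  rw [Finset.card_univ, Fintype.card_fun, Fintype.card_fin] at this
  rw [← this]
  congr 2
  ext
  simp

/-- The geometric sum `(q - 1) p_{k - 1} = q ^ k - 1`; for `k = 0` it uses `p_{-1} = 0`. -/
theorem pred_mul_projCount_add_one {q : ℕ} (hq : 1 ≤ q) (k : ℕ) :
    (q - 1) * projCount q ((k : ℤ) - 1) + 1 = q ^ k := by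
  rcases k with _ | k
  · simp [projCount]
  · have h : projCount q (((k + 1 : ℕ) : ℤ) - 1) = ∑ i ∈ Finset.range (k + 1), q ^ i := by
      simp [projCount]
    rw [h]
    obtain ⟨p, rfl⟩ := Nat.exists_eq_add_of_le hq
    have := geom_sum_mul_add p (k + 1)
    rw [add_comm 1 p, Nat.add_sub_cancel, mul_comm]
    exact this

/-! ### Averaging over a linear system -/

/-- At most `q ^ (r + 1) - q ^ r` vectors have nonzero dot product with a given `u` (equality holds
unless `u = 0`). -/
theorem card_linear_ne_zero_le {K : Type*} [Field K] [Fintype K] [DecidableEq K] {r : ℕ}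
    (u : Fin (r + 1) → K) :
    (Finset.univ.filter fun c : Fin (r + 1) → K => ∑ i, c i * u i ≠ 0).card ≤
      (Fintype.card K - 1) * Fintype.card K ^ r := by
  classical
  rcases eq_or_ne u 0 with rfl | hu
  · simp
  obtain ⟨i, hi⟩ := Function.ne_iff.1 hu
  have hi : u i ≠ 0 := hi
  -- The dot product with `u` and the coordinates other than `i` determine `c`.
  have hinj : (Finset.univ.filter fun c : Fin (r + 1) → K => ∑ i, c i * u i ≠ 0).card ≤
      ((Finset.univ.erase (0 : K)) ×ˢ (Finset.univ : Finset (Fin r → K))).card := by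
    refine Finset.card_le_card_of_injOn (fun c => (∑ j, c j * u j, fun j => c (i.succAbove j))) ?_ ?_
    · intro c hc
      simpa using hc
    · intro c _ c' _ h
      simp only [Prod.mk.injEq] at h
      obtain ⟨h1, h2⟩ := h
      have h2 : ∀ j, c (i.succAbove j) = c' (i.succAbove j) := fun j => congrFun h2 j
      rw [Fin.sum_univ_succAbove _ i, Fin.sum_univ_succAbove _ i] at h1
      simp only [h2, add_left_inj, mul_eq_mul_right_iff, hi, or_false] at h1
      funext j
      rcases Fin.eq_self_or_eq_succAbove i j with rfl | ⟨k, rfl⟩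
      · exact h1
      · exact h2 k
  simpa [Finset.card_product, Finset.card_erase_of_mem] using hinj

/-- Here `r = s + 1` and `m = s + k + 1`, so that `k = m - r`: at least `q ^ m - q ^ (m - r)` vectors
are not common zeros. -/
theorem pow_le_card_add_pow {K : Type*} [Field K] [Fintype K] [DecidableEq K] {s k : ℕ}
    (F : Fin (s + 1) → MvPolynomial (Fin (s + k + 1 + 1)) K)
    (hF : ∀ i, (F i).IsHomogeneous (Fintype.card K)) (hli : LinearIndependent K F) :
    Fintype.card K ^ (s + k + 1) ≤
      (Finset.univ.filter fun v : Fin (s + k + 1 + 1) → K => ¬ ∀ i, eval v (F i) = 0).card +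
        Fintype.card K ^ k := by
  have hq : 2 ≤ Fintype.card K := Fintype.one_lt_card
  set N := (Finset.univ.filter fun v : Fin (s + k + 1 + 1) → K => ¬ ∀ i, eval v (F i) = 0).card with hN
  have hev : ∀ (c : Fin (s + 1) → K) v, eval v (∑ i, c i • F i) = ∑ i, c i * eval v (F i) := by
    intro c v
    simp [smul_eval]
  -- Count the pairs of a combination `c` and a vector `v` at which it does not vanish: `hlow`
  -- bounds their number from below for each `c`, and `hup` from above by summing over `v`.
  have hlow : ∀ c ∈ Finset.univ.erase (0 : Fin (s + 1) → K),
      (Fintype.card K - 1) * Fintype.card K ^ (s + k) ≤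
        (Finset.univ.filter fun v => ∑ i, c i * eval v (F i) ≠ 0).card := by
    intro c hc
    have hne : ∑ i, c i • F i ≠ 0 := fun h =>
      (Finset.ne_of_mem_erase hc) (funext (Fintype.linearIndependent_iff.1 hli c h))
    have hhom : (∑ i, c i • F i).IsHomogeneous (Fintype.card K) :=
      (homogeneousSubmodule _ K (Fintype.card K)).sum_mem fun i _ =>
        Submodule.smul_mem _ _ (hF i)
    have := card_eval_ne_zero_of_isHomogeneous_card hhom hne
    simpa only [hev] using this
  have hup : ∑ c : Fin (s + 1) → K,
      (Finset.univ.filter fun v => ∑ i, c i * eval v (F i) ≠ 0).card ≤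
        N * ((Fintype.card K - 1) * Fintype.card K ^ s) := by
    simp only [Finset.card_filter]
    rw [Finset.sum_comm]
    simp only [← Finset.card_filter]
    rw [hN, ← smul_eq_mul, ← Finset.sum_const, Finset.sum_filter]
    refine Finset.sum_le_sum fun v _ => ?_
    by_cases h : ∀ i, eval v (F i) = 0
    · simp [h]
    · rw [if_pos h]
      exact card_linear_ne_zero_le fun i => eval v (F i)
  have hsum := (Finset.sum_le_sum hlow).trans
    ((Finset.sum_le_sum_of_subset (Finset.erase_subset _ _)).trans hup)
  rw [Finset.sum_const, Finset.card_erase_of_mem (Finset.mem_univ _), Finset.card_univ,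
    Fintype.card_fun, Fintype.card_fin, smul_eq_mul] at hsum
  set q := Fintype.card K
  have h : (q ^ (s + 1) - 1) * q ^ k ≤ N := by
    have hpos : 0 < (q - 1) * q ^ s := Nat.mul_pos (by omega) (by positivity)
    refine Nat.le_of_mul_le_mul_right ?_ hpos
    calc _ = (q ^ (s + 1) - 1) * ((q - 1) * q ^ (s + k)) := by ring
      _ ≤ _ := hsum
  rw [Nat.sub_mul, one_mul, ← pow_add, Nat.sub_le_iff_le_add] at h
  rwa [show s + k + 1 = s + 1 + k by ring]

theorem ncard_projZeros_le {K : Type*} [Field K] [Fintype K] {s k : ℕ}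
    (F : Fin (s + 1) → MvPolynomial (Fin (s + k + 1 + 1)) K)
    (hF : ∀ i, (F i).IsHomogeneous (Fintype.card K)) (hli : LinearIndependent K F) :
    (projZeros F).ncard ≤ Fintype.card K ^ (s + k + 1) + projCount (Fintype.card K) ((k : ℤ) - 1) := by
  classical
  have hq : 2 ≤ Fintype.card K := Fintype.one_lt_card
  have h1 := pow_le_card_add_pow F hF hli
  have h2 := ncard_projZeros F hF (by omega)
  have h3 := pred_mul_projCount_add_one (q := Fintype.card K) (by omega) k
  obtain ⟨p, hp⟩ := Nat.exists_eq_add_of_le (show 1 ≤ Fintype.card K by omega)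
  set q := Fintype.card K
  have hp' : q - 1 = p := by omega
  rw [hp'] at h2 h3
  have h4 : q ^ (s + k + 1 + 1) = q ^ (s + k + 1) * p + q ^ (s + k + 1) := by
    rw [pow_succ q (s + k + 1)]
    nth_rewrite 2 [hp]
    ring
  refine Nat.le_of_mul_le_mul_right (c := p) ?_ (by omega)
  rw [h4] at h2
  rw [add_mul, mul_comm (projCount _ _)]
  omega

/-! ### Forms attaining the bound -/

/-- The forms `X_i (X_0 ^ (q - 1) - X_i ^ (q - 1))`, `1 ≤ i ≤ r`, which vanish wherever
`X_0 ≠ 0`, while for `X_0 = 0` their common zeros are those of `X_1, …, X_r`. -/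
noncomputable def extremalForms (K : Type*) [Field K] (q r k : ℕ) (i : Fin r) :
    MvPolynomial (Fin (r + k + 1)) K :=
  X (i.castAdd k).succ * (X 0 ^ (q - 1) - X (i.castAdd k).succ ^ (q - 1))

theorem isHomogeneous_extremalForms {K : Type*} [Field K] {q r k : ℕ} (hq : 1 ≤ q) (i : Fin r) :
    (extremalForms K q r k i).IsHomogeneous q := by
  have h := (isHomogeneous_X K (i.castAdd k).succ).mul
    (((isHomogeneous_X K (0 : Fin (r + k + 1))).pow (q - 1)).sub
      ((isHomogeneous_X K (i.castAdd k).succ).pow (q - 1)))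
  have e : 1 + 1 * (q - 1) = q := by omega
  rwa [e] at h

/-- The monomial `X_j ^ q` occurs in the `j`-th form only. -/
theorem linearIndependent_extremalForms {K : Type*} [Field K] {q r k : ℕ} (hq : 2 ≤ q) :
    LinearIndependent K (extremalForms K q r k) := by
  rw [Fintype.linearIndependent_iff]
  intro c hc j
  have hj := congrArg (coeff (Finsupp.single (j.castAdd k).succ q)) hc
  have hform : ∀ i, coeff (Finsupp.single (j.castAdd k).succ q) (extremalForms K q r k i) =
      if i = j then -1 else 0 := by
    intro i
    have e : extremalForms K q r k i =
        X (i.castAdd k).succ * X 0 ^ (q - 1) - X (i.castAdd k).succ ^ q := by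
      obtain ⟨p, rfl⟩ := Nat.exists_eq_add_of_le' (show 1 ≤ q by omega)
      rw [extremalForms, Nat.add_sub_cancel]
      ring
    have h0 : (Finsupp.single (i.castAdd k).succ 1 + Finsupp.single 0 (q - 1) :
        Fin (r + k + 1) →₀ ℕ) ≠ Finsupp.single (j.castAdd k).succ q := by
      intro h
      have := DFunLike.congr_fun h 0
      simp at this
      omega
    rw [e, coeff_sub, coeff_X_pow, X_pow_eq_monomial, X, monomial_mul, coeff_monomial, if_neg h0]
    have : (Finsupp.single (i.castAdd k).succ q = Finsupp.single (j.castAdd k).succ q) ↔ i = j := by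
      rw [Finsupp.single_left_inj (by omega)]
      simp
    simp only [this]
    split_ifs <;> simp
  simpa [coeff_sum, hform] using hj

theorem le_ncard_projZeros_extremalForms {K : Type*} [Field K] [Fintype K] {r k : ℕ} :
    Fintype.card K ^ (r + k) + projCount (Fintype.card K) ((k : ℤ) - 1) ≤
      (projZeros (extremalForms K (Fintype.card K) r k)).ncard := by
  classical
  have hq : 2 ≤ Fintype.card K := Fintype.one_lt_card
  have h2 := ncard_projZeros (extremalForms K (Fintype.card K) r k)
    (fun i => isHomogeneous_extremalForms (by omega) i) (by omega)
  have h3 := pred_mul_projCount_add_one (q := Fintype.card K) (by omega) k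
  set N := (Finset.univ.filter fun v : Fin (r + k + 1) → K =>
    ¬ ∀ i, eval v (extremalForms K (Fintype.card K) r k i) = 0).card with hN
  -- A vector off the cone has `X_0 = 0` and is not among the `q ^ k` vectors with
  -- `X_0 = ⋯ = X_r = 0`.
  have h1 : N + Fintype.card K ^ k ≤ Fintype.card K ^ (r + k) := by
    set e : (Fin k → K) → (Fin (r + k + 1) → K) := fun w =>
      Fin.cons 0 (Fin.append (0 : Fin r → K) w) with he
    have hinj : Function.Injective e := fun w w' h => by
      funext j
      simpa [he] using congrFun h (j.natAdd r).succ
    have hdisj : Disjoint (Finset.univ.filter fun v : Fin (r + k + 1) → K =>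
        ¬ ∀ i, eval v (extremalForms K (Fintype.card K) r k i) = 0)
        (Finset.univ.image e) := by
      rw [Finset.disjoint_right]
      intro v hv hv'
      obtain ⟨w, -, rfl⟩ := Finset.mem_image.1 hv
      refine (Finset.mem_filter.1 hv').2 fun i => ?_
      simp [extremalForms, he]
    have hcard := Finset.card_union_of_disjoint hdisj
    rw [Finset.card_image_of_injective _ hinj, Finset.card_univ, Fintype.card_fun,
      Fintype.card_fin, ← hN] at hcard
    rw [← hcard]
    have : Fintype.card K ^ (r + k) = (Finset.univ.image fun w : Fin (r + k) → K =>
        (Fin.cons 0 w : Fin (r + k + 1) → K)).card := by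
      rw [Finset.card_image_of_injective _ (Fin.cons_right_injective _), Finset.card_univ,
        Fintype.card_fun, Fintype.card_fin]
    rw [this]
    refine Finset.card_le_card (Finset.union_subset ?_ ?_)
    · intro v hv
      refine Finset.mem_image.2 ⟨Fin.tail v, Finset.mem_univ _, ?_⟩
      have h0 : v 0 = 0 := by
        by_contra h0
        refine (Finset.mem_filter.1 hv).2 fun i => ?_
        have hx := FiniteField.pow_card_sub_one_eq_one (v 0) h0
        by_cases hi : v (i.castAdd k).succ = 0
        · simp [extremalForms, hi]
        · simp [extremalForms, hx, FiniteField.pow_card_sub_one_eq_one _ hi]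
      rw [← h0, Fin.cons_self_tail]
    · intro v hv
      obtain ⟨w, -, rfl⟩ := Finset.mem_image.1 hv
      exact Finset.mem_image.2 ⟨_, Finset.mem_univ _, rfl⟩
  obtain ⟨p, hp⟩ := Nat.exists_eq_add_of_le (show 1 ≤ Fintype.card K by omega)
  set q := Fintype.card K
  have hp' : q - 1 = p := by omega
  rw [hp'] at h2 h3
  have h4 : q ^ (r + k + 1) = q ^ (r + k) * p + q ^ (r + k) := by
    rw [pow_succ q (r + k)]
    nth_rewrite 2 [hp]
    ring
  refine Nat.le_of_mul_le_mul_right (c := p) ?_ (by omega)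
  rw [h4] at h2
  rw [add_mul, mul_comm (projCount _ _)]
  omega

theorem maxZeros_card {K : Type*} [Field K] [Finite K] {m r : ℕ} (hr : 1 ≤ r) (hrm : r ≤ m) :
    maxZeros K r (Nat.card K) m =
      Nat.card K ^ m + projCount (Nat.card K) ((m : ℤ) - r - 1) := by
  have := Fintype.ofFinite K
  have hq : 2 ≤ Fintype.card K := Fintype.one_lt_card
  rw [Nat.card_eq_fintype_card]
  obtain ⟨s, rfl⟩ := Nat.exists_eq_add_of_le' hr
  obtain ⟨k, rfl⟩ := Nat.exists_eq_add_of_le hrm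
  have hk : ((s + 1 + k : ℕ) : ℤ) - (s + 1 : ℕ) - 1 = (k : ℤ) - 1 := by push_cast; ring
  rw [hk]
  have hmem : (projZeros (extremalForms K (Fintype.card K) (s + 1) k)).ncard ∈
      zeroCounts K (s + 1) (Fintype.card K) (s + 1 + k) :=
    ⟨_, isHomogeneous_extremalForms (by omega), linearIndependent_extremalForms hq, rfl⟩
  have hgr := isGreatest_maxZeros K (s + 1) (Fintype.card K) (s + 1 + k) ⟨_, hmem⟩
  refine le_antisymm ?_ (le_ncard_projZeros_extremalForms.trans (hgr.2 hmem))
  obtain ⟨F, hF, hli, hN⟩ := hgr.1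
  rw [hN]
  clear hN hgr hmem hk hrm hr
  have e : s + 1 + k = s + k + 1 := by ring
  revert F
  rw [e]
  intro F hF hli
  exact ncard_projZeros_le F hF hli

/-! ### The lexicographic count `H_r(q - 1, m)` -/

/-- Only the largest tuple `(d, 0, …, 0)`, which has rank `1`, has first entry `d`. -/
theorem apply_zero_ne_of_isRthTuple {r d m : ℕ} (hr : 2 ≤ r) {β : Lex (Fin (m + 1) → ℕ)}
    (hβ : IsRthTuple r d (m + 1) β) : ofLex β 0 ≠ d := by
  intro h0
  have hrest : ∀ γ ∈ boundedTuples d (m + 1), d ≤ ofLex γ 0 →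
      ofLex γ = Fin.cons d (0 : Fin m → ℕ) := by
    intro γ hγ hd
    have hγ : ∑ i, ofLex γ i ≤ d := hγ
    rw [Fin.sum_univ_succ] at hγ
    have hz : ∑ i : Fin m, ofLex γ i.succ = 0 := by omega
    funext i
    refine Fin.cases ?_ (fun j => ?_) i
    · rw [Fin.cons_zero]
      omega
    · rw [Fin.cons_succ]
      exact Finset.sum_eq_zero_iff.1 hz j (Finset.mem_univ j)
  have hsub : {γ ∈ boundedTuples d (m + 1) | β ≤ γ} ⊆ {β} := by
    rintro γ ⟨hγ, hle⟩
    have hle0 : ofLex β 0 ≤ ofLex γ 0 := by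
      rcases hle.eq_or_lt with rfl | ⟨i, hi, hlt⟩
      · exact le_rfl
      · rcases Fin.eq_zero_or_eq_succ i with rfl | ⟨j, rfl⟩
        · exact hlt.le
        · exact (hi 0 (Fin.succ_pos j)).le
    refine ofLex.injective ?_
    rw [hrest γ hγ (h0 ▸ hle0), hrest β hβ.1 h0.ge]
  have := Set.ncard_le_ncard hsub
  rw [hβ.2, Set.ncard_singleton] at this
  omega

theorem heijnenPellikaan_le {q r n : ℕ} (hq : 2 ≤ q) (hr : 2 ≤ r) :
    heijnenPellikaan q r (q - 1) (n + 2) ≤ (q - 2) * q ^ (n + 1) + q ^ n := by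
  rw [heijnenPellikaan]
  split_ifs with h
  swap
  · exact Nat.zero_le _
  have hβ := h.choose_spec
  set β := h.choose
  have hsum : ∑ i, ofLex β i ≤ q - 1 := hβ.1
  have h0 := apply_zero_ne_of_isRthTuple hr hβ
  rw [Fin.sum_univ_succ] at hsum ⊢
  set b := ofLex β 0
  have htail : ∑ i : Fin (n + 1), ofLex β i.succ * q ^ (n + 2 - 1 - (i.succ : ℕ)) ≤
      (∑ i : Fin (n + 1), ofLex β i.succ) * q ^ n := by
    rw [Finset.sum_mul]
    refine Finset.sum_le_sum fun i _ => Nat.mul_le_mul_left _ ?_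
    refine Nat.pow_le_pow_right (by omega) ?_
    rw [Fin.val_succ]
    omega
  set S := ∑ i : Fin (n + 1), ofLex β i.succ
  -- The entries after `b = q - 2 - c` sum to at most `c + 1`, so lowering the first entry does not pay.
  obtain ⟨c, hc⟩ := Nat.exists_eq_add_of_le (show b ≤ q - 2 by omega)
  have hS : S ≤ c + 1 := by omega
  have e : n + 2 - 1 - ((0 : Fin (n + 2)) : ℕ) = n + 1 := by simp
  rw [e]
  calc _ ≤ b * q ^ (n + 1) + (c + 1) * q ^ n :=
        Nat.add_le_add_left (htail.trans (Nat.mul_le_mul_right _ hS)) _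
    _ = b * q ^ (n + 1) + c * q ^ n + q ^ n := by ring
    _ ≤ b * q ^ (n + 1) + c * q ^ (n + 1) + q ^ n := by
        gcongr
        · omega
        · omega
    _ = _ := by rw [hc]; ring

theorem heijnenPellikaan_add_projCount_lt {q r m : ℕ} (hq : 3 ≤ q) (hr : 2 ≤ r) (hm : 2 ≤ m) :
    heijnenPellikaan q r (q - 1) m + projCount q ((m : ℤ) - 1) < q ^ m := by
  obtain ⟨n, rfl⟩ := Nat.exists_eq_add_of_le' hm
  have h1 := heijnenPellikaan_le (n := n) (show 2 ≤ q by omega) hr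
  have h2 := pred_mul_projCount_add_one (show 1 ≤ q by omega) (n + 2)
  set H := heijnenPellikaan q r (q - 1) (n + 2)
  set P := projCount q (((n + 2 : ℕ) : ℤ) - 1)
  obtain ⟨p, rfl⟩ := Nat.exists_eq_add_of_le' hq
  have e1 : p + 3 - 2 = p + 1 := by omega
  have e2 : p + 3 - 1 = p + 2 := by omega
  rw [e1] at h1
  rw [e2] at h2
  set Q := (p + 3) ^ n
  have e3 : (p + 3) ^ (n + 1) = (p + 3) * Q := by simp only [Q]; ring
  have e4 : (p + 3) ^ (n + 2) = (p + 3) ^ 2 * Q := by simp only [Q]; ring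
  rw [e3] at h1
  rw [e4] at h2 ⊢
  refine Nat.lt_of_mul_lt_mul_left (a := p + 2) ?_
  nlinarith [Nat.mul_le_mul_left (p + 2) h1, Nat.zero_le (p * Q), Nat.zero_le (p ^ 2 * Q)]

/-! ### The maximal number of zeros and its comparison with `H_r(q - 1, m) + p_{m - 1}` -/

theorem theorem5p2 (q : ℕ) (hq : 3 ≤ q) (K : Type*) [Field K] [Finite K] (hK : Nat.card K = q)
    (m : ℕ) :
    (∀ r : ℕ, 1 ≤ r → r ≤ m →
      maxZeros K r q m = q ^ m + projCount q ((m : ℤ) - r - 1)) ∧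
    (∀ r : ℕ, 1 < r → r ≤ m →
      heijnenPellikaan q r (q - 1) m + projCount q ((m : ℤ) - 1) < maxZeros K r q m) ∧
    (2 ≤ m → ¬ ∀ r : ℕ, 1 ≤ r → r ≤ (m + q - 1).choose (q - 1) →
      maxZeros K r q m = heijnenPellikaan q r (q - 1) m + projCount q ((m : ℤ) - 1)) := by
  have hmax : ∀ r : ℕ, 1 ≤ r → r ≤ m →
      maxZeros K r q m = q ^ m + projCount q ((m : ℤ) - r - 1) := by
    intro r hr hrm
    rw [← hK]
    exact maxZeros_card hr hrm
  have hlt : ∀ r : ℕ, 1 < r → r ≤ m →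
      heijnenPellikaan q r (q - 1) m + projCount q ((m : ℤ) - 1) < maxZeros K r q m := by
    intro r hr hrm
    rw [hmax r hr.le hrm]
    exact (heijnenPellikaan_add_projCount_lt hq hr (by omega)).trans_le (Nat.le_add_right _ _)
  refine ⟨hmax, hlt, fun hm h => ?_⟩
  -- The formula already fails for `r = 2`, which is in the range since `(m + q - 1).choose (q - 1) ≥ q`.
  refine (hlt 2 one_lt_two hm).ne' (h 2 one_le_two ?_)
  calc 2 ≤ q := by omega
    _ = (q - 1 + 1).choose (q - 1) := by rw [Nat.choose_succ_self_right]; omega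
    _ ≤ _ := Nat.choose_le_choose _ (by omega)
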